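/- All graphs $G=(V,E)$ are finite, simple, undirected and connected, $d$ is the combinatorial distance and $\operatorname{diam}(G)=\max_{x,y\in V}d(x,y)$. For probability measures $\mu_1,\mu_2$ on $V$ let $$W_1(\mu_1,\mu_2)=\inf_\pi \sum_{x,y\in V} d(x,y)\,\pi(x,y),$$ where $\pi$ runs over all maps $V\times V\to[0,1]$ with $\mu_1(x)=\sum_{y}\pi(x,y)$ and $\mu_2(y)=\sum_{x}\pi(x,y)$. For a $D$-regular graph $G$ and $x\in V$ let $\mu_x$ be the uniform probability measure on the ball $B_1(x)$ of $x$ and its $D$ neighbours, and for different vertices $x,y$ put $$\kappa(x,y)=\frac{D+1}{D}\left(1-\frac{W_1(\mu_x,\mu_y)}{d(x,y)}\right).$$ A $D$-regular graph $G$ of diameter $L$ with $\inf_{x\sim y}\kappa(x,y)>0$ is called $(D,L)$-Bonnet-Myers sharp if $\inf_{x\sim y}\kappa(x,y)=\frac{2}{L}$. It is called self-centered if for every $x\in V$ there is $\bar x\in V$ with $d(x,\bar x)=\operatorname{diam}(G)$. The cocktail party graph $CP(n)$ has vertex set $\{u_1,\dots,u_n,v_1,\dots,v_n\}$, where two vertices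 are adjacent unless they share the same subscript. **Theorem.** Let $G$ be a $(D,2)$-Bonnet-Myers sharp graph. Then $G$ is self-centered, and $G$ is isomorphic to a cocktail party graph $CP(n)$ for some $n\ge 2$. -/

import Mathlib

namespace BonnetMyers

section Transport

variable {V : Type*} [Fintype V] (G : SimpleGraph V)

/-- `π : V × V → [0,1]` is a transport plan from `μ₁` to `μ₂`: its marginals are `μ₁` and `μ₂`. -/
def IsTransportPlan (μ₁ μ₂ : V → ℝ) (π : V → V → ℝ) : Prop :=
  (∀ x y, π x y ∈ Set.Icc (0 : ℝ) 1) ∧ (∀ x, μ₁ x = ∑ y, π x y) ∧ (∀ y, μ₂ y = ∑ x, π x y)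

/-- The cost of a transport plan, with respect to the combinatorial distance of `G`. -/
noncomputable def transportCost (π : V → V → ℝ) : ℝ :=
  ∑ x, ∑ y, (G.dist x y : ℝ) * π x y

/-- The Wasserstein distance `W₁`: the infimum of the costs of all transport plans. -/
noncomputable def wasserstein (μ₁ μ₂ : V → ℝ) : ℝ :=
  sInf {c : ℝ | ∃ π : V → V → ℝ, IsTransportPlan μ₁ μ₂ π ∧ c = transportCost G π}

end Transport

section Curvature

variable {V : Type*} [Fintype V] [DecidableEq V] (G : SimpleGraph V) [DecidableRel G.Adj]

/-- The measure `μ_x^p`: mass `p` at `x` and mass `(1 - p) / d_x` at each neighbour of `x`. -/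
noncomputable def idleMeasure (p : ℝ) (x z : V) : ℝ :=
  if z = x then p else if G.Adj x z then (1 - p) / (G.degree x : ℝ) else 0

/-- The `p`-Ollivier Ricci curvature `κ_p(x,y)` of two different vertices. -/
noncomputable def ollivierCurvature (p : ℝ) (x y : V) : ℝ :=
  1 - wasserstein G (idleMeasure G p x) (idleMeasure G p y) / (G.dist x y : ℝ)

/-- The curvature `κ(x,y) = ((D+1)/D) κ_{1/(D+1)}(x,y)` of a `D`-regular graph. -/
noncomputable def curvature (D : ℕ) (x y : V) : ℝ :=
  ((D : ℝ) + 1) / (D : ℝ) * ollivierCurvature G (1 / ((D : ℝ) + 1)) x y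

/-- The infimum of `κ(x,y)` over all edges `x ∼ y`. -/
noncomputable def infCurvature (D : ℕ) : ℝ :=
  sInf {k : ℝ | ∃ x y : V, G.Adj x y ∧ k = curvature G D x y}

/-- `G` is `(D,L)`-Bonnet-Myers sharp: a connected `D`-regular graph of diameter `L` whose
curvature on edges has positive infimum, equal to `2 / L`. -/
structure IsBonnetMyersSharp (D L : ℕ) : Prop where
  connected : G.Connected
  regular : G.IsRegularOfDegree D
  diam_eq : G.diam = L
  inf_pos : 0 < infCurvature G D
  inf_eq : infCurvature G D = 2 / (L : ℝ)

end Curvature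

/-- `x` is a pole: some vertex (an antipole of `x`) lies at distance `diam G` from `x`. -/
def IsPole {V : Type*} (G : SimpleGraph V) (x : V) : Prop :=
  ∃ y, G.dist x y = G.diam

/-- `G` is self-centered: every vertex is a pole. -/
def IsSelfCentered {V : Type*} (G : SimpleGraph V) : Prop :=
  ∀ x, IsPole G x

/-- The cocktail party graph `CP(n)`: vertices `u_i = (i, 0)` and `v_i = (i, 1)`, any two of them
adjacent unless they share the same subscript. -/
def cocktailPartyGraph (n : ℕ) : SimpleGraph (Fin n × Fin 2) where
  Adj a b := a.1 ≠ b.1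
  symm := ⟨fun _ _ h => h.symm⟩
  loopless := ⟨fun _ h => h rfl⟩

end BonnetMyers

namespace BonnetMyers

open Finset

/-! ### Weak Kantorovich duality -/

section Transport

variable {V : Type*} [Fintype V] (G : SimpleGraph V)

/-! For `L = 2` every edge has curvature at least `1`, so by duality the sum of a `1`-Lipschitz
function over a unit ball drops by at most `1` along an edge. Testing with an indicator and with a
distance function shows that the ends of an edge have at most one private neighbour each, and that
these two are adjacent. Hence a neighbour of `x` is adjacent to every non-neighbour of `x`
(`adj_of_adj_of_not_adj`), which makes the non-neighbour unique (`eq_of_not_adj`). Regularity and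
diameter two give its existence, so non-adjacency splits `V` into pairs. -/

/-- Weak Kantorovich duality for a single transport plan. -/
theorem IsTransportPlan.sum_sub_sum_le_transportCost {μ₁ μ₂ : V → ℝ} {π : V → V → ℝ}
    (hπ : IsTransportPlan μ₁ μ₂ π) {f : V → ℝ} (hf : ∀ a b, f a - f b ≤ G.dist a b) :
    ∑ a, f a * μ₁ a - ∑ a, f a * μ₂ a ≤ transportCost G π := by
  obtain ⟨h01, h1, h2⟩ := hπ
  have e1 : ∑ a, f a * μ₁ a = ∑ a, ∑ b, f a * π a b :=
    sum_congr rfl fun a _ => by rw [h1, mul_sum]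
  have e2 : ∑ b, f b * μ₂ b = ∑ a, ∑ b, f b * π a b := by
    rw [sum_comm]
    exact sum_congr rfl fun b _ => by rw [h2, mul_sum]
  rw [e1, e2, ← sum_sub_distrib]
  refine sum_le_sum fun a _ => ?_
  rw [← sum_sub_distrib]
  refine sum_le_sum fun b _ => ?_
  rw [← sub_mul]
  exact mul_le_mul_of_nonneg_right (hf a b) (h01 a b).1

/-- The product of two probability measures is a transport plan between them. -/
theorem isTransportPlan_mul {μ₁ μ₂ : V → ℝ} (h1 : ∀ a, 0 ≤ μ₁ a) (h2 : ∀ a, 0 ≤ μ₂ a)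
    (s1 : ∑ a, μ₁ a = 1) (s2 : ∑ a, μ₂ a = 1) :
    IsTransportPlan μ₁ μ₂ fun a b => μ₁ a * μ₂ b := by
  have le_one : ∀ {μ : V → ℝ}, (∀ a, 0 ≤ μ a) → ∑ a, μ a = 1 → ∀ a, μ a ≤ 1 :=
    fun h s a => s ▸ single_le_sum (fun b _ => h b) (mem_univ a)
  refine ⟨fun a b => ⟨mul_nonneg (h1 a) (h2 b), ?_⟩, fun a => ?_, fun b => ?_⟩
  · exact mul_le_one₀ (le_one h1 s1 a) (h2 b) (le_one h2 s2 b)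
  · rw [← mul_sum, s2, mul_one]
  · rw [← sum_mul, s1, one_mul]

/-- Weak Kantorovich duality. -/
theorem sum_sub_sum_le_wasserstein {μ₁ μ₂ : V → ℝ} (h1 : ∀ a, 0 ≤ μ₁ a) (h2 : ∀ a, 0 ≤ μ₂ a)
    (s1 : ∑ a, μ₁ a = 1) (s2 : ∑ a, μ₂ a = 1) {f : V → ℝ}
    (hf : ∀ a b, f a - f b ≤ G.dist a b) :
    ∑ a, f a * μ₁ a - ∑ a, f a * μ₂ a ≤ wasserstein G μ₁ μ₂ := by
  -- The product plan makes the set of costs nonempty; `sInf ∅` would be `0`.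
  refine le_csInf ⟨_, _, isTransportPlan_mul h1 h2 s1 s2, rfl⟩ ?_
  rintro _ ⟨π, hπ, rfl⟩
  exact hπ.sum_sub_sum_le_transportCost G hf

end Transport

/-! ### Curvature and unit balls -/

section Curvature

variable {V : Type*} [Fintype V] [DecidableEq V] (G : SimpleGraph V) [DecidableRel G.Adj]

/-- The closed ball of radius one. -/
def closedBall (x : V) : Finset V := insert x (G.neighborFinset x)

variable {G}

theorem mem_closedBall {x z : V} : z ∈ closedBall G x ↔ z = x ∨ G.Adj x z := by
  simp [closedBall]

theorem card_closedBall {D : ℕ} (hreg : G.IsRegularOfDegree D) (x : V) :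
    #(closedBall G x) = D + 1 := by
  rw [closedBall, card_insert_of_notMem (by simp), G.card_neighborFinset_eq_degree, hreg x]

theorem idleMeasure_eq_ite {D : ℕ} (hreg : G.IsRegularOfDegree D) (hD : D ≠ 0) (x z : V) :
    idleMeasure G (1 / ((D : ℝ) + 1)) x z
      = if z ∈ closedBall G x then 1 / ((D : ℝ) + 1) else 0 := by
  have : (D : ℝ) ≠ 0 := by exact_mod_cast hD
  have : (D : ℝ) + 1 ≠ 0 := by positivity
  have key : (1 - 1 / ((D : ℝ) + 1)) / D = 1 / ((D : ℝ) + 1) := by field_simp; ring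
  simp only [idleMeasure, mem_closedBall, hreg x, key]
  by_cases h : z = x <;> simp [h]

theorem sum_mul_idleMeasure {D : ℕ} (hreg : G.IsRegularOfDegree D) (hD : D ≠ 0) (x : V)
    (f : V → ℝ) :
    ∑ a, f a * idleMeasure G (1 / ((D : ℝ) + 1)) x a
      = (∑ a ∈ closedBall G x, f a) / ((D : ℝ) + 1) := by
  simp only [idleMeasure_eq_ite hreg hD, mul_ite, mul_zero, sum_ite_mem, univ_inter, sum_div,
    mul_one_div]

/-- An edge of curvature at least one changes ball sums of `1`-Lipschitz functions by at most
one. -/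
theorem sum_closedBall_sub_le_one {D : ℕ} (hreg : G.IsRegularOfDegree D) {x y : V}
    (hxy : G.Adj x y) (hc : 1 ≤ curvature G D x y) {f : V → ℝ}
    (hf : ∀ a b, f a - f b ≤ G.dist a b) :
    ∑ a ∈ closedBall G x, f a - ∑ a ∈ closedBall G y, f a ≤ 1 := by
  have hD : D ≠ 0 := by
    rintro rfl
    have := (G.degree_pos_iff_exists_adj x).2 ⟨y, hxy⟩
    rw [hreg x] at this
    omega
  have hD0 : (0 : ℝ) < D := by positivity
  have nonneg : ∀ u a, 0 ≤ idleMeasure G (1 / ((D : ℝ) + 1)) u a := fun u a => by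
    rw [idleMeasure_eq_ite hreg hD]
    split_ifs <;> positivity
  have total : ∀ u, ∑ a, idleMeasure G (1 / ((D : ℝ) + 1)) u a = 1 := fun u => by
    have := sum_mul_idleMeasure hreg hD u fun _ => 1
    simp only [one_mul, sum_const, card_closedBall hreg, nsmul_eq_mul, mul_one] at this
    rw [this]
    push_cast
    exact div_self (by positivity)
  have hW := sum_sub_sum_le_wasserstein G (nonneg x) (nonneg y) (total x) (total y) hf
  rw [sum_mul_idleMeasure hreg hD, sum_mul_idleMeasure hreg hD, ← sub_div,
    div_le_iff₀ (by positivity)] at hW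
  rw [curvature, ollivierCurvature, SimpleGraph.dist_eq_one_iff_adj.2 hxy, Nat.cast_one, div_one,
    div_mul_eq_mul_div, le_div_iff₀ hD0] at hc
  -- `hc` now says `D ≤ (D + 1) * (1 - W₁)`, that is `(D + 1) * W₁ ≤ 1`.
  linarith

theorem one_le_dist {V : Type*} {G : SimpleGraph V} (hconn : G.Connected) {a b : V}
    (h : a ≠ b) : (1 : ℝ) ≤ G.dist a b := by
  exact_mod_cast hconn.pos_dist_of_ne h

/-- An edge of curvature at least one has at most one private neighbour on each side. -/
theorem card_closedBall_sdiff_le_one {D : ℕ} (hconn : G.Connected)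
    (hreg : G.IsRegularOfDegree D) {x y : V} (hxy : G.Adj x y) (hc : 1 ≤ curvature G D x y) :
    #(closedBall G x \ closedBall G y) ≤ 1 := by
  -- An indicator is `1`-Lipschitz because distinct vertices are at distance at least `1`.
  have h := sum_closedBall_sub_le_one hreg hxy hc
    (f := fun a => if a ∈ closedBall G x \ closedBall G y then 1 else 0) fun a b => by
      rcases eq_or_ne a b with rfl | hab
      · simp
      · have := one_le_dist hconn hab
        split_ifs <;> linarith
  rw [sum_ite_mem, sum_ite_mem, inter_sdiff_self, sum_empty,
    inter_eq_right.2 sdiff_subset, sum_const, nsmul_eq_mul, mul_one, sub_zero] at h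
  exact_mod_cast h

/-- The private neighbours of the ends of an edge of curvature at least one are adjacent. -/
theorem adj_of_closedBall_sdiff {D : ℕ} (hconn : G.Connected) (hreg : G.IsRegularOfDegree D)
    {x y x' y' : V} (hxy : G.Adj x y) (hc : 1 ≤ curvature G D x y)
    (hx : closedBall G x \ closedBall G y = {x'}) (hy : closedBall G y \ closedBall G x = {y'}) :
    G.Adj x' y' := by
  -- For the distance to `y'`, the common part of the balls cancels and `d(x', y')` remains.
  have h := sum_closedBall_sub_le_one hreg hxy hc
    (f := fun a => (G.dist a y' : ℝ)) fun a b => by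
      have := hconn.dist_triangle (u := a) (v := b) (w := y')
      have : (G.dist a y' : ℝ) ≤ G.dist a b + G.dist b y' := by exact_mod_cast this
      linarith
  rw [← sum_sdiff_sub_sum_sdiff, hx, hy, sum_singleton, sum_singleton, G.dist_self] at h
  have h1 : G.dist x' y' ≤ 1 := by
    have : (G.dist x' y' : ℝ) ≤ 1 := by simpa using h
    exact_mod_cast this
  have hne : x' ≠ y' := by
    rintro rfl
    have h1 : x' ∈ closedBall G x \ closedBall G y := by simp [hx]
    have h2 : x' ∈ closedBall G y \ closedBall G x := by simp [hy]
    exact (mem_sdiff.1 h1).2 (mem_sdiff.1 h2).1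
  exact SimpleGraph.dist_eq_one_iff_adj.1 (le_antisymm h1 (hconn.pos_dist_of_ne hne))

theorem infCurvature_le {D : ℕ} {x y : V} (hxy : G.Adj x y) :
    infCurvature G D ≤ curvature G D x y := by
  refine csInf_le (Set.Finite.bddBelow ?_) ⟨x, y, hxy, rfl⟩
  refine (Set.finite_range fun p : V × V => curvature G D p.1 p.2).subset ?_
  rintro _ ⟨a, b, -, rfl⟩
  exact ⟨(a, b), rfl⟩

/-! ### Structure in diameter two -/

namespace IsBonnetMyersSharp

variable {D : ℕ}

theorem one_le_curvature (hG : IsBonnetMyersSharp G D 2) {x y : V} (hxy : G.Adj x y) :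
    1 ≤ curvature G D x y := by
  have := infCurvature_le (D := D) hxy
  rw [hG.inf_eq] at this
  norm_num at this
  exact this

theorem eq_of_adj_of_not_adj (hG : IsBonnetMyersSharp G D 2) {x y a b : V} (hxy : G.Adj x y)
    (ha : G.Adj x a) (hb : G.Adj x b) (hay : a ≠ y) (hby : b ≠ y) (hya : ¬ G.Adj y a)
    (hyb : ¬ G.Adj y b) : a = b := by
  refine card_le_one.1 (card_closedBall_sdiff_le_one hG.connected hG.regular hxy
    (hG.one_le_curvature hxy)) a ?_ b ?_ <;> simp [mem_closedBall, *]

/-- The two balls have equal size, so the private neighbour `z` of `y` forces one of `x`. -/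
theorem exists_closedBall_sdiff_eq (hG : IsBonnetMyersSharp G D 2) {x y z : V}
    (hxy : G.Adj x y) (hyz : G.Adj y z) (hzx : z ≠ x) (hxz : ¬ G.Adj x z) :
    ∃ y', closedBall G x \ closedBall G y = {y'} ∧ G.Adj y' z := by
  have hz : closedBall G y \ closedBall G x = {z} := by
    have hmem : z ∈ closedBall G y \ closedBall G x := by simp [mem_closedBall, *]
    refine eq_singleton_iff_unique_mem.2 ⟨hmem, fun b hb => ?_⟩
    exact card_le_one.1 (card_closedBall_sdiff_le_one hG.connected hG.regular hxy.symm
      (hG.one_le_curvature hxy.symm)) b hb z hmem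
  have hcard : #(closedBall G x \ closedBall G y) = 1 := by
    rw [card_sdiff_comm (by rw [card_closedBall hG.regular, card_closedBall hG.regular]), hz,
      card_singleton]
  obtain ⟨y', hy'⟩ := card_eq_one.1 hcard
  exact ⟨y', hy', adj_of_closedBall_sdiff hG.connected hG.regular hxy
    (hG.one_le_curvature hxy) hy' hz⟩

theorem dist_le_two (hG : IsBonnetMyersSharp G D 2) (x y : V) : G.dist x y ≤ 2 := by
  have h := hG.diam_eq
  -- `diam` is `0` when `ediam = ⊤`, so diameter `2` rules that out.
  exact h ▸ SimpleGraph.dist_le_diam (SimpleGraph.ediam_ne_top_of_diam_ne_zero (by omega))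

theorem dist_eq_two (hG : IsBonnetMyersSharp G D 2) {x z : V} (hzx : z ≠ x)
    (hxz : ¬ G.Adj x z) : G.dist x z = 2 := by
  have h0 := hG.connected.pos_dist_of_ne hzx.symm
  have h1 : G.dist x z ≠ 1 := fun h => hxz (SimpleGraph.dist_eq_one_iff_adj.1 h)
  have h2 := hG.dist_le_two x z
  omega

theorem exists_adj_adj (hG : IsBonnetMyersSharp G D 2) {x z : V} (hzx : z ≠ x)
    (hxz : ¬ G.Adj x z) : ∃ y, G.Adj x y ∧ G.Adj y z := by
  obtain ⟨p, hp⟩ := hG.connected.exists_walk_length_eq_dist x z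
  rw [hG.dist_eq_two hzx hxz] at hp
  match p, hp with
  | .cons h (.cons h' .nil), _ => exact ⟨_, h, h'⟩

theorem adj_of_adj_of_not_adj (hG : IsBonnetMyersSharp G D 2) {x z w : V} (hzx : z ≠ x)
    (hxz : ¬ G.Adj x z) (hxw : G.Adj x w) : G.Adj w z := by
  by_contra hwz
  obtain ⟨y, hxy, hyz⟩ := hG.exists_adj_adj hzx hxz
  obtain ⟨y', hy', hyz'⟩ := hG.exists_closedBall_sdiff_eq hxy hyz hzx hxz
  -- The private neighbour `y'` of `x` is adjacent to `z`, so `w` is not `y'` and must be adjacent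
  -- to `y`. Then `x` and `w` are both private to `y` along the edge `y ∼ z`.
  have hwy : w ≠ y := fun h => hwz (h ▸ hyz)
  have hyw : G.Adj y w := by
    by_contra h
    have hmem : w ∈ closedBall G x \ closedBall G y := by simp [mem_closedBall, hxw, hwy, h]
    rw [hy', mem_singleton] at hmem
    exact hwz (hmem ▸ hyz')
  have hwz' : w ≠ z := fun h => hxz (h ▸ hxw)
  exact hxw.ne (hG.eq_of_adj_of_not_adj hyz hxy.symm hyw hzx.symm hwz' (fun h => hxz h.symm)
    fun h => hwz h.symm)

theorem eq_of_not_adj (hG : IsBonnetMyersSharp G D 2) {x z w : V} (hzx : z ≠ x)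
    (hxz : ¬ G.Adj x z) (hwx : w ≠ x) (hxw : ¬ G.Adj x w) : z = w := by
  obtain ⟨y, hxy, hyz⟩ := hG.exists_adj_adj hzx hxz
  exact hG.eq_of_adj_of_not_adj hxy.symm hyz (hG.adj_of_adj_of_not_adj hwx hxw hxy) hzx hwx
    hxz hxw

/-- If one unit ball were all of `V`, by regularity all would be, and the diameter would be at most
`1`. -/
theorem exists_not_adj (hG : IsBonnetMyersSharp G D 2) (x : V) : ∃ z, z ≠ x ∧ ¬ G.Adj x z := by
  by_contra! h
  have hx : closedBall G x = univ := eq_univ_of_forall fun z => by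
    rw [mem_closedBall]
    exact or_iff_not_imp_left.2 (h z)
  have := hG.connected.nonempty
  obtain ⟨u, v, huv⟩ := G.exists_dist_eq_diam
  have hu : closedBall G u = univ := by
    rw [← card_eq_iff_eq_univ, card_closedBall hG.regular, ← card_closedBall hG.regular x, hx,
      card_univ]
  rw [hG.diam_eq] at huv
  have hv : v ∈ closedBall G u := hu ▸ mem_univ v
  rcases mem_closedBall.1 hv with rfl | hv
  · simp at huv
  · rw [SimpleGraph.dist_eq_one_iff_adj.2 hv] at huv
    omega

/-- Non-adjacency is an equivalence relation. -/
def nonAdjSetoid (hG : IsBonnetMyersSharp G D 2) : Setoid V where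
  r x y := ¬ G.Adj x y
  iseqv :=
    { refl := fun _ => G.irrefl
      symm := fun h h' => h h'.symm
      trans := fun {a b c} hab hbc hac => by
        have h1 : a ≠ b := fun h => hbc (h ▸ hac)
        have h2 : c ≠ b := fun h => hab (h ▸ hac)
        exact hac.ne (hG.eq_of_not_adj h1 (fun h => hab h.symm) h2 hbc) }

theorem mk_eq_mk_iff (hG : IsBonnetMyersSharp G D 2) {x y : V} :
    Quotient.mk hG.nonAdjSetoid x = Quotient.mk hG.nonAdjSetoid y ↔ ¬ G.Adj x y :=
  Quotient.eq (r := hG.nonAdjSetoid)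

theorem card_fiber_mk (hG : IsBonnetMyersSharp G D 2) (q : Quotient hG.nonAdjSetoid) :
    Nat.card {x // Quotient.mk hG.nonAdjSetoid x = q} = 2 := by
  induction q using Quotient.inductionOn with | _ x
  obtain ⟨z, hzx, hxz⟩ := hG.exists_not_adj x
  refine Nat.card_eq_two_iff.2 ⟨⟨x, rfl⟩, ⟨z, hG.mk_eq_mk_iff.2 fun h => hxz h.symm⟩,
    fun h => hzx (congrArg Subtype.val h).symm, Set.eq_univ_of_forall fun ⟨w, hw⟩ => ?_⟩
  have hxw : ¬ G.Adj x w := hG.mk_eq_mk_iff.1 hw.symm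
  rcases eq_or_ne w x with rfl | hwx
  · exact Or.inl rfl
  · exact Or.inr (Subtype.ext (hG.eq_of_not_adj hwx hxw hzx hxz))

theorem isSelfCentered (hG : IsBonnetMyersSharp G D 2) : IsSelfCentered G := fun x => by
  obtain ⟨z, hzx, hxz⟩ := hG.exists_not_adj x
  exact ⟨z, (hG.dist_eq_two hzx hxz).trans hG.diam_eq.symm⟩

theorem exists_iso_cocktailPartyGraph (hG : IsBonnetMyersSharp G D 2) :
    ∃ n : ℕ, 2 ≤ n ∧ Nonempty (G ≃g cocktailPartyGraph n) := by
  let n := Nat.card (Quotient hG.nonAdjSetoid)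
  let i : Quotient hG.nonAdjSetoid ≃ Fin n := Finite.equivFin _
  let E : V ≃ Fin n × Fin 2 :=
    (Equiv.sigmaFiberEquiv (Quotient.mk hG.nonAdjSetoid)).symm.trans <|
      (Equiv.sigmaCongrRight fun q => Finite.equivFinOfCardEq (hG.card_fiber_mk q)).trans <|
        (Equiv.sigmaEquivProd _ _).trans (i.prodCongr (Equiv.refl _))
  -- The first coordinate of `E` is the index of the class, which alone decides adjacency.
  have hE : ∀ x, (E x).1 = i (Quotient.mk hG.nonAdjSetoid x) := fun _ => rfl
  refine ⟨n, ?_, ⟨⟨E, fun {x y} => ?_⟩⟩⟩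
  · obtain ⟨x⟩ := hG.connected.nonempty
    obtain ⟨z, hzx, hxz⟩ := hG.exists_not_adj x
    obtain ⟨y, hxy, -⟩ := hG.exists_adj_adj hzx hxz
    have : Nontrivial (Quotient hG.nonAdjSetoid) :=
      ⟨_, _, fun h => hG.mk_eq_mk_iff.1 h hxy⟩
    exact Finite.one_lt_card
  · change (E x).1 ≠ (E y).1 ↔ _
    rw [hE, hE, i.injective.ne_iff, Ne, hG.mk_eq_mk_iff, not_not]

end IsBonnetMyersSharp

end Curvature

end BonnetMyers

theorem mainTheorem12 {V : Type*} [Fintype V] [DecidableEq V] (G : SimpleGraph V)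
    [DecidableRel G.Adj] (D : ℕ) (hG : BonnetMyers.IsBonnetMyersSharp G D 2) :
    BonnetMyers.IsSelfCentered G ∧
      ∃ n : ℕ, 2 ≤ n ∧ Nonempty (G ≃g BonnetMyers.cocktailPartyGraph n) := by
  exact ⟨hG.isSelfCentered, hG.exists_iso_cocktailPartyGraph⟩
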